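/- A cyclic order on a set $X$ is a relation $Z\subseteq X^3$ such that $(x,y,z)\in Z$ implies $(y,z,x)\in Z$ and $(z,y,x)\notin Z$, and $(x,y,z),(x,z,u)\in Z$ imply $(x,y,u)\in Z$; it is total if for all distinct $x,y,z$ one of $(x,y,z),(z,y,x)$ lies in $Z$. Distinct elements $y_1,\dots,y_p$ ($p\ge3$) form a $Z$-chain $(y_1,\dots,y_p)$ if $(y_1,y_{i-1},y_i)\in Z$ for $3\le i\le p$. Put $c_Z(x,y)=\#\{z:(x,z,y)\in Z\}$ and $\tilde c_Z(y_1,\dots,y_p)=(c_Z(y_1,y_2),\dots,c_Z(y_{p-1},y_p),c_Z(y_p,y_1))$. Let $n\ge2$, $w=\epsilon_1\cdots\epsilon_n\in\{+,-\}^n$ and $N=n+2$. Let $\mathcal P_w$ be the set of total cyclic orders $Z$ on $\{1,\dots,N\}$ such that, for $1\le i\le n$, $(i,i+1,i+2)\in Z$ if $\epsilon_i=+$ and $(i+2,i+1,i)\in Z$ if $\epsilon_i=-$. For $\eta_1,\eta_2\in\{+,-\}$ let $\mathcal R_w^{\eta_1,\eta_2}$ be the set of $Z\in\mathcal P_w$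 with $(N-1,N,1)\in Z$ if $\eta_1=+$, $(1,N,N-1)\in Z$ if $\eta_1=-$, $(N,1,2)\in Z$ if $\eta_2=+$, and $(2,1,N)\in Z$ if $\eta_2=-$. For $1\le\alpha\le6$ let $\mathcal R_w^{(\alpha)}$ be the set of $Z\in\mathcal P_w$ for which the following is a $Z$-chain: $(1,2,N-1,N)$ for $\alpha=1$; $(1,N-1,2,N)$ for $\alpha=2$; $(1,N-1,N,2)$ for $\alpha=3$; $(1,2,N,N-1)$ for $\alpha=4$; $(1,N,2,N-1)$ for $\alpha=5$; $(1,N,N-1,2)$ for $\alpha=6$. Let $g^{(\alpha)}_{w,i,j,k,\ell}$ be the number of $Z\in\mathcal R_w^{(\alpha)}$ such that, respectively, \begin{align*} \alpha=1:&\ \tilde c_Z(N-1,N,1,2)=(i,j,k,\ell), & \alpha=2:&\ \tilde c_Z(N-1,2,N,1)=(i,\ell,j,k),\\ \alpha=3:&\ \tilde c_Z(N,2,1,N-1)=(i,j,k,\ell), & \alpha=4:&\ \tilde c_Z(N,N-1,1,2)=(i,j,k,\ell),\\ \alpha=5:&\ \tilde c_Z(N,2,N-1,1)=(i,\ell,j,k),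 & \alpha=6:&\ \tilde c_Z(N-1,2,1,N)=(i,j,k,\ell), \end{align*} and set $R_w^{(\alpha)}=\sum_{i+j+k+\ell=n-2} g^{(\alpha)}_{w,i,j,k,\ell}X_1^iX_2^jX_3^kX_4^\ell$ (sum over nonnegative integers). For $b\ne c$ let $\Phi_{a,b,c}$ be the $\mathbb Z$-linear endomorphism of $\mathbb Z[X_1,\dots,X_4]$ with $$\Phi_{a,b,c}\Big(\prod_{\ell}X_\ell^{i_\ell}\Big)=\Big(\prod_{\ell\notin\{b,c\}}X_\ell^{i_\ell}\Big)X_a^{i_b+1}\sum_{k=0}^{i_c}X_b^{i_c-k}X_c^k .$$ Write $w+$ and $w-$ for the words obtained by appending $+$ and $-$ to $w$. Then: (1) For every $n\ge2$ and every $w\in\{+,-\}^n$, \begin{align*} R_{w+}^{(1)}&=\Phi_{4,1,2}(R_w^{(1)})+\Phi_{3,1,2}(R_w^{(2)})+\Phi_{2,2,1}(R_w^{(4)}),\\ R_{w+}^{(2)}&=\Phi_{3,4,2}(R_w^{(3)})+\Phi_{2,2,4}(R_w^{(5)}),\\ R_{w+}^{(3)}&=\Phi_{3,4,1}(R_w^{(3)})+\Phi_{2,4,1}(R_w^{(5)})+\Phi_{1,1,4}(R_w^{(6)}),\\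 R_{w+}^{(4)}&=\Phi_{1,1,4}(R_w^{(1)}),\\ R_{w+}^{(5)}&=\Phi_{4,1,3}(R_w^{(1)})+\Phi_{1,1,3}(R_w^{(2)}),\\ R_{w+}^{(6)}&=\Phi_{4,4,3}(R_w^{(3)}),\\ R_{w-}^{(1)}&=\Phi_{1,1,2}(R_w^{(4)}),\\ R_{w-}^{(2)}&=\Phi_{1,4,2}(R_w^{(6)})+\Phi_{4,4,2}(R_w^{(5)}),\\ R_{w-}^{(3)}&=\Phi_{4,4,1}(R_w^{(6)}),\\ R_{w-}^{(4)}&=\Phi_{2,1,4}(R_w^{(4)})+\Phi_{3,1,4}(R_w^{(2)})+\Phi_{4,4,1}(R_w^{(1)}),\\ R_{w-}^{(5)}&=\Phi_{2,1,3}(R_w^{(4)})+\Phi_{3,3,1}(R_w^{(2)}),\\ R_{w-}^{(6)}&=\Phi_{1,4,3}(R_w^{(6)})+\Phi_{2,4,3}(R_w^{(5)})+\Phi_{3,3,4}(R_w^{(3)}). \end{align*} (2) $R_{++}^{(1)}=R_{--}^{(2)}=R_{-+}^{(3)}=R_{+-}^{(4)}=R_{++}^{(5)}=R_{--}^{(6)}=1$,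 and all other $R_{\epsilon_1\epsilon_2}^{(\alpha)}$ are $0$. (3) For every $n\ge2$ and $w\in\{+,-\}^n$, writing $\Sigma^{(\alpha)}=R_w^{(\alpha)}(1,1,1,1)$, $$\#\mathcal R_w^{+,+}=\Sigma^{(1)}+\Sigma^{(2)},\quad \#\mathcal R_w^{+,-}=\Sigma^{(3)},\quad \#\mathcal R_w^{-,+}=\Sigma^{(4)},\quad \#\mathcal R_w^{-,-}=\Sigma^{(5)}+\Sigma^{(6)},$$ so that the recurrences (1) with the initial values (2) compute every $\#\mathcal R_w^{\eta_1,\eta_2}$ with $n\ge2$. -/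

import Mathlib

namespace CyclicBoustrophedon

/-! ### Cyclic orders -/

/-- A cyclic order on `X`: a cyclic, asymmetric and transitive ternary relation `Z ⊆ X³`. -/
structure IsCyclicOrder {X : Type*} (Z : Set (X × X × X)) : Prop where
  cyclic : ∀ x y z : X, (x, y, z) ∈ Z → (y, z, x) ∈ Z
  asymm : ∀ x y z : X, (x, y, z) ∈ Z → (z, y, x) ∉ Z
  trans : ∀ x y z u : X, (x, y, z) ∈ Z → (x, z, u) ∈ Z → (x, y, u) ∈ Z

/-- A total cyclic order: every triple of distinct elements is ordered one way or the other. -/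
structure IsTotalCyclicOrder {X : Type*} (Z : Set (X × X × X)) : Prop extends
    IsCyclicOrder Z where
  total : ∀ x y z : X, x ≠ y → y ≠ z → x ≠ z → (x, y, z) ∈ Z ∨ (z, y, x) ∈ Z

/-- The content of the arc from `i` to `j`: the number of `x` with `(i, x, j) ∈ Z`. -/
noncomputable def content {X : Type*} (Z : Set (X × X × X)) (i j : X) : ℕ :=
  {x : X | (i, x, j) ∈ Z}.ncard

/-- The multi-content `(c(y₁, y₂), …, c(y_{p-1}, y_p), c(y_p, y₁))` of a `p`-tuple
(the addition `i + 1` in `Fin p` is cyclic). -/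
noncomputable def multiContent {X : Type*} (Z : Set (X × X × X)) {p : ℕ} [NeZero p]
    (y : Fin p → X) : Fin p → ℕ :=
  fun i => content Z (y i) (y (i + 1))

/-- `(y₁, …, y_p)`, with distinct entries and `p ≥ 3`, forms a `Z`-chain if
`(y₁, y_{i-1}, y_i) ∈ Z` for all `3 ≤ i ≤ p`. -/
def IsZChain {X : Type*} (Z : Set (X × X × X)) {p : ℕ} (y : Fin p → X) : Prop :=
  Function.Injective y ∧ 3 ≤ p ∧
    ∀ (i : ℕ) (hi : i + 2 < p),
      (y ⟨0, by omega⟩, y ⟨i + 1, by omega⟩, y ⟨i + 2, hi⟩) ∈ Z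

/-! ### Words, and the classes of total cyclic orders they prescribe

A word `w` with `n` letters is a map `Fin n → Letter`. It prescribes total cyclic orders on
`[N] = {1, …, N}`, where `N = n + 2`; the element `i` of `[N]` is represented by the element of
`Fin (n + 2)` with value `i - 1`. -/

/-- The letters `+` and `-`. -/
inductive Letter : Type
  | plus : Letter
  | minus : Letter

/-- The word obtained by appending the letter `e` at the end of `w`. -/
def append {n : ℕ} (w : Fin n → Letter) (e : Letter) : Fin (n + 1) → Letter :=
  Fin.snoc (α := fun _ => Letter) w e

/-- The element `1` of `[N]`, where `N = n + 2`. -/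
def one (n : ℕ) : Fin (n + 2) := ⟨0, by omega⟩

/-- The element `2` of `[N]`, where `N = n + 2`. -/
def two (n : ℕ) : Fin (n + 2) := ⟨1, by omega⟩

/-- The element `N - 1` of `[N]`, where `N = n + 2`. -/
def penult (n : ℕ) : Fin (n + 2) := ⟨n, by omega⟩

/-- The element `N` of `[N]`, where `N = n + 2`. -/
def ult (n : ℕ) : Fin (n + 2) := ⟨n + 1, by omega⟩

/-- The triple `x, y, z` is positively (letter `+`) or negatively (letter `-`)
oriented: `(x, y, z) ∈ Z`, respectively `(z, y, x) ∈ Z`. -/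
def Oriented {X : Type*} (Z : Set (X × X × X)) (e : Letter) (x y z : X) : Prop :=
  match e with
  | .plus => (x, y, z) ∈ Z
  | .minus => (z, y, x) ∈ Z

/-- The set `𝓟_w`. -/
def classP {n : ℕ} (w : Fin n → Letter) : Set (Set (Fin (n + 2) × Fin (n + 2) × Fin (n + 2))) :=
  {Z | IsTotalCyclicOrder Z ∧
    ∀ i : Fin n, Oriented Z (w i) ⟨i, by omega⟩ ⟨i + 1, by omega⟩ ⟨i + 2, by omega⟩}

/-- The set `𝓠_w^η`. -/
def classQ {n : ℕ} (w : Fin n → Letter) (η : Letter) :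
    Set (Set (Fin (n + 2) × Fin (n + 2) × Fin (n + 2))) :=
  {Z | Z ∈ classP w ∧ Oriented Z η (penult n) (ult n) (one n)}

/-- The set `𝓡_w^{η₁, η₂}`. -/
def classR {n : ℕ} (w : Fin n → Letter) (η₁ η₂ : Letter) :
    Set (Set (Fin (n + 2) × Fin (n + 2) × Fin (n + 2))) :=
  {Z | Z ∈ classQ w η₁ ∧ Oriented Z η₂ (ult n) (one n) (two n)}

/-- The six chain types of the four elements `1, 2, N - 1, N`. -/
inductive ChainType : Type
  | c1 : ChainType
  | c2 : ChainType
  | c3 : ChainType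
  | c4 : ChainType
  | c5 : ChainType
  | c6 : ChainType

/-- The elements `1, 2, N - 1, N` in the order in which they form a chain of the given type. -/
def chainOf (n : ℕ) : ChainType → Fin 4 → Fin (n + 2)
  | .c1 => ![one n, two n, penult n, ult n]
  | .c2 => ![one n, penult n, two n, ult n]
  | .c3 => ![one n, penult n, ult n, two n]
  | .c4 => ![one n, two n, ult n, penult n]
  | .c5 => ![one n, ult n, two n, penult n]
  | .c6 => ![one n, ult n, penult n, two n]

/-- The set `𝓡_w^{(α)}`. -/
def chainClass {n : ℕ} (w : Fin n → Letter) (α : ChainType) :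
    Set (Set (Fin (n + 2) × Fin (n + 2) × Fin (n + 2))) :=
  {Z | Z ∈ classP w ∧ IsZChain Z (chainOf n α)}

/-- The number `g_{w,i,j,k,l}^{(α)}` of elements of `𝓡_w^{(α)}` with prescribed arc contents. -/
noncomputable def g {n : ℕ} (w : Fin n → Letter) (α : ChainType) (i j k l : ℕ) : ℕ :=
  match α with
  | .c1 => {Z | Z ∈ chainClass w .c1 ∧
      multiContent Z ![penult n, ult n, one n, two n] = ![i, j, k, l]}.ncard
  | .c2 => {Z | Z ∈ chainClass w .c2 ∧
      multiContent Z ![penult n, two n, ult n, one n] = ![i, l, j, k]}.ncard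
  | .c3 => {Z | Z ∈ chainClass w .c3 ∧
      multiContent Z ![ult n, two n, one n, penult n] = ![i, j, k, l]}.ncard
  | .c4 => {Z | Z ∈ chainClass w .c4 ∧
      multiContent Z ![ult n, penult n, one n, two n] = ![i, j, k, l]}.ncard
  | .c5 => {Z | Z ∈ chainClass w .c5 ∧
      multiContent Z ![ult n, two n, penult n, one n] = ![i, l, j, k]}.ncard
  | .c6 => {Z | Z ∈ chainClass w .c6 ∧
      multiContent Z ![penult n, two n, one n, ult n] = ![i, j, k, l]}.ncard

/-- The generating polynomial `R_w^{(α)}`; the variable `X_ℓ` is `MvPolynomial.X (ℓ - 1)`. -/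
noncomputable def genR {n : ℕ} (w : Fin n → Letter) (α : ChainType) : MvPolynomial (Fin 4) ℤ :=
  ∑ v ∈ Finset.Nat.antidiagonalTuple 4 (n - 2),
    MvPolynomial.C (g w α (v 0) (v 1) (v 2) (v 3) : ℤ) *
      (MvPolynomial.X 0 ^ v 0 * MvPolynomial.X 1 ^ v 1 *
        MvPolynomial.X 2 ^ v 2 * MvPolynomial.X 3 ^ v 3)

/-! ### The operators `Φ_{a,b,c}` -/

/-- The image of the monomial `∏ X_ℓ ^ (s ℓ)` under `Φ_{a,b,c}`. -/
noncomputable def PhiMonomial {m : ℕ} (a b c : Fin m) (s : Fin m →₀ ℕ) :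
    MvPolynomial (Fin m) ℤ :=
  (∏ ℓ ∈ Finset.univ \ {b, c}, MvPolynomial.X ℓ ^ s ℓ) * MvPolynomial.X a ^ (s b + 1) *
    ∑ k ∈ Finset.range (s c + 1), MvPolynomial.X b ^ (s c - k) * MvPolynomial.X c ^ k

/-- The linear endomorphism `Φ_{a,b,c}` of `ℤ[X_1, …, X_m]` (meant for `b ≠ c`), defined by its
action on monomials. The indices in `Fin m` count from `0`: `Φ_{a,b,c}` is
`Phi (a - 1) (b - 1) (c - 1)`. -/
noncomputable def Phi {m : ℕ} (a b c : Fin m) :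
    MvPolynomial (Fin m) ℤ →ₗ[ℤ] MvPolynomial (Fin m) ℤ :=
  (MvPolynomial.basisMonomials (Fin m) ℤ).constr ℤ (PhiMonomial a b c)

theorem Phi_monomial {m : ℕ} (a b c : Fin m) (s : Fin m →₀ ℕ) :
    Phi a b c (MvPolynomial.monomial s 1) = PhiMonomial a b c s := by
  have h := (MvPolynomial.basisMonomials (Fin m) ℤ).constr_basis ℤ (PhiMonomial a b c) s
  rwa [MvPolynomial.coe_basisMonomials] at h

/-- For each chain type, the only two-letter word that can be realised by that chain type. -/
def initialWord : ChainType → Fin 2 → Letter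
  | .c1 => ![.plus, .plus]
  | .c2 => ![.minus, .minus]
  | .c3 => ![.minus, .plus]
  | .c4 => ![.plus, .minus]
  | .c5 => ![.plus, .plus]
  | .c6 => ![.minus, .minus]

end CyclicBoustrophedon

open CyclicBoustrophedon

/-! A total cyclic order on `M` elements is the same thing as a bijective numbering of the elements
by the positions `0, …, M - 1` of a circle, once the element `0` is required to sit at position `0`:
cut the circle at `0` and count how many elements come before a given one
(`exists_ofRank_eq`, `injOn_ofRank`). In these terms the content of an arc is a difference of
positions (`content_ofRank`), the chain type of `1, 2, N - 1, N` is the relative order of three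
positions, and the polynomial `R_w^{(α)}` is the sum of the monomials `∏ X_ℓ ^ (arcs ℓ)` over the
numberings that belong to `𝓡_w^{(α)}` (`genR_eq`).

A numbering of `N + 1` elements arises from exactly one numbering of `N` elements by inserting the
element `N + 1` just behind some position `t` (`sum_isRank_succ`). The insertion does not disturb
the orientations among the old elements, so the conditions imposed by `w` are inherited, and what
remains is a condition on `t` alone. The marked elements `1, 2, N - 1, N` cut the old circle into
four arcs. The orientation of `(N - 1, N, N + 1)` together with the chain type of `1, 2, N, N + 1`
says precisely in which of these arcs `N + 1` lies, and every arc gives one of the `4 · 6` operators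
of the recurrences. Inserting into an arc with `i` inner points cuts it into two arcs with `i - k`
and `k` inner points, `0 ≤ k ≤ i`, while the two arcs meeting at `N - 1` merge and absorb `N - 1`:
the result is the polynomial `Φ_{a,b,c}` of the monomial (`sum_insertions`). Summing over all
numberings gives the recurrences (`genR_append`).

For words of length two, each chain type determines the numbering of the four elements
(`ranks_two`). The cardinalities follow because the signs `η₁`, `η₂` only restrict the relative
order of the positions of `2, N - 1, N`, that is, the chain type (`ncard_classR`). -/

namespace CyclicBoustrophedon

/-! ### Total cyclic orders as rank functions -/

/-- The numbers `a, b, c` are distinct and are met in this cyclic order on a circle whose positions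
are numbered by an initial segment of `ℕ`. -/
def Cyc (a b c : ℕ) : Prop :=
  (a < b ∧ b < c) ∨ (b < c ∧ c < a) ∨ (c < a ∧ a < b)

/-- The ternary relation obtained by placing each `x` at the position `f x` of a circle whose
`M` positions are numbered `0, …, M - 1`. -/
def ofRank {M : ℕ} (f : Fin M → Fin M) : Set (Fin M × Fin M × Fin M) :=
  {t | Cyc (f t.1) (f t.2.1) (f t.2.2)}

@[simp]
theorem mem_ofRank {M : ℕ} (f : Fin M → Fin M) (x y z : Fin M) :
    (x, y, z) ∈ ofRank f ↔ Cyc (f x) (f y) (f z) := Iff.rfl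

/-- A rank function: a bijective numbering of the elements which starts at the element `0`. -/
def IsRank {M : ℕ} [NeZero M] (f : Fin M → Fin M) : Prop :=
  Function.Injective f ∧ f 0 = 0

theorem IsRank.val_ne {M : ℕ} [NeZero M] {f : Fin M → Fin M} (hf : IsRank f) {x y : Fin M}
    (h : x ≠ y) : (f x : ℕ) ≠ f y :=
  fun h' => h (hf.1 (Fin.ext h'))

theorem IsRank.val_zero {M : ℕ} [NeZero M] {f : Fin M → Fin M} (hf : IsRank f) :
    (f 0 : ℕ) = 0 := by
  simp [hf.2]

theorem isTotalCyclicOrder_ofRank {M : ℕ} [NeZero M] {f : Fin M → Fin M} (hf : IsRank f) :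
    IsTotalCyclicOrder (ofRank f) where
  cyclic x y z h := by simp only [mem_ofRank, Cyc] at *; omega
  asymm x y z h := by simp only [mem_ofRank, Cyc] at *; omega
  trans x y z u h h' := by simp only [mem_ofRank, Cyc] at *; omega
  total x y z hxy hyz hxz := by
    have h1 := hf.val_ne hxy
    have h2 := hf.val_ne hyz
    have h3 := hf.val_ne hxz
    simp only [mem_ofRank, Cyc]
    omega

/-- The linear order cut out of a cyclic order at the element `0`, which becomes the least one. -/
def Before {M : ℕ} [NeZero M] (Z : Set (Fin M × Fin M × Fin M)) (x y : Fin M) : Prop :=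
  (x = 0 ∧ y ≠ 0) ∨ (0, x, y) ∈ Z

theorem IsCyclicOrder.ne {X : Type*} {Z : Set (X × X × X)} (hZ : IsCyclicOrder Z) {x y z : X}
    (h : (x, y, z) ∈ Z) : x ≠ y ∧ y ≠ z ∧ x ≠ z := by
  have h1 := hZ.cyclic _ _ _ h
  have h2 := hZ.cyclic _ _ _ h1
  refine ⟨?_, ?_, ?_⟩ <;> rintro rfl
  · exact hZ.asymm _ _ _ h h2
  · exact hZ.asymm _ _ _ h h1
  · exact hZ.asymm _ _ _ h h

section Before

variable {M : ℕ} [NeZero M] {Z : Set (Fin M × Fin M × Fin M)}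

theorem not_before_self (hZ : IsCyclicOrder Z) (x : Fin M) : ¬ Before Z x x := by
  rintro (⟨h, h'⟩ | h)
  · exact h' h
  · exact (hZ.ne h).2.1 rfl

theorem Before.trans (hZ : IsCyclicOrder Z) {x y z : Fin M} (h : Before Z x y)
    (h' : Before Z y z) : Before Z x z := by
  rcases h with ⟨hx, hy⟩ | h
  · rcases h' with ⟨hy', -⟩ | h'
    · exact absurd hy' hy
    · exact Or.inl ⟨hx, (hZ.ne h').2.2.symm⟩
  · rcases h' with ⟨hy', -⟩ | h'
    · exact absurd hy'.symm (hZ.ne h).2.2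
    · exact Or.inr (hZ.trans _ _ _ _ h h')

theorem before_trichotomy (hZ : IsTotalCyclicOrder Z) {x y : Fin M} (h : x ≠ y) :
    Before Z x y ∨ Before Z y x := by
  by_cases hx : x = 0
  · exact Or.inl (Or.inl ⟨hx, fun hy => h (hx.trans hy.symm)⟩)
  by_cases hy : y = 0
  · exact Or.inr (Or.inl ⟨hy, hx⟩)
  rcases hZ.total 0 x y (Ne.symm hx) h (Ne.symm hy) with h | h
  · exact Or.inl (Or.inr h)
  · exact Or.inr (Or.inr (hZ.cyclic _ _ _ (hZ.cyclic _ _ _ h)))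

/-- The orientation of `x, y, z` follows from the triples `(0, x, y)` and `(0, y, z)` by turning them
so that they start with `y` and applying transitivity there. -/
theorem mem_of_before (hZ : IsCyclicOrder Z) {x y z : Fin M} (h : Before Z x y)
    (h' : Before Z y z) : (x, y, z) ∈ Z := by
  rcases h with ⟨rfl, hy⟩ | h
  · rcases h' with ⟨hy', -⟩ | h'
    · exact absurd hy' hy
    · exact h'
  · rcases h' with ⟨hy', -⟩ | h'
    · exact absurd hy'.symm (hZ.ne h).2.2
    · have h1 : (y, 0, x) ∈ Z := hZ.cyclic _ _ _ (hZ.cyclic _ _ _ h)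
      have h2 : (y, z, x) ∈ Z := hZ.trans _ _ _ _ (hZ.cyclic _ _ _ h') h1
      exact hZ.cyclic _ _ _ (hZ.cyclic _ _ _ h2)

end Before

open Classical in
/-- The rank of `x` in a cyclic order: the number of elements met before `x` when starting
from `0`. -/
noncomputable def rank {M : ℕ} [NeZero M] (Z : Set (Fin M × Fin M × Fin M)) (x : Fin M) : ℕ :=
  (Finset.univ.filter fun y => Before Z y x).card

theorem rank_lt_rank {M : ℕ} [NeZero M] {Z : Set (Fin M × Fin M × Fin M)}
    (hZ : IsCyclicOrder Z) {x y : Fin M} (h : Before Z x y) : rank Z x < rank Z y := by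
  classical
  refine Finset.card_lt_card ((Finset.ssubset_iff_of_subset ?_).2 ⟨x, ?_, ?_⟩)
  · intro z hz
    simp only [Finset.mem_filter, Finset.mem_univ, true_and] at *
    exact hz.trans hZ h
  · simpa using h
  · simpa using not_before_self hZ x

theorem rank_lt {M : ℕ} [NeZero M] {Z : Set (Fin M × Fin M × Fin M)}
    (hZ : IsCyclicOrder Z) (x : Fin M) : rank Z x < M := by
  classical
  have h : rank Z x < (Finset.univ : Finset (Fin M)).card := by
    refine Finset.card_lt_card ((Finset.ssubset_iff_of_subset (Finset.subset_univ _)).2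
      ⟨x, Finset.mem_univ _, ?_⟩)
    simpa using not_before_self hZ x
  simpa using h

theorem before_iff_rank_lt {M : ℕ} [NeZero M] {Z : Set (Fin M × Fin M × Fin M)}
    (hZ : IsTotalCyclicOrder Z) {x y : Fin M} : Before Z x y ↔ rank Z x < rank Z y := by
  refine ⟨rank_lt_rank hZ.toIsCyclicOrder, fun h => ?_⟩
  have hxy : x ≠ y := by rintro rfl; exact lt_irrefl _ h
  refine (before_trichotomy hZ hxy).resolve_right fun h' => ?_
  exact lt_asymm h (rank_lt_rank hZ.toIsCyclicOrder h')

theorem exists_ofRank_eq {M : ℕ} [NeZero M] {Z : Set (Fin M × Fin M × Fin M)}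
    (hZ : IsTotalCyclicOrder Z) : ∃ f : Fin M → Fin M, IsRank f ∧ ofRank f = Z := by
  have hc := hZ.toIsCyclicOrder
  have key : ∀ x y z, Cyc (rank Z x) (rank Z y) (rank Z z) → (x, y, z) ∈ Z := by
    intro x y z h
    simp only [Cyc, ← before_iff_rank_lt hZ] at h
    rcases h with h | h | h
    · exact mem_of_before hc h.1 h.2
    · exact hc.cyclic _ _ _ (hc.cyclic _ _ _ (mem_of_before hc h.1 h.2))
    · exact hc.cyclic _ _ _ (mem_of_before hc h.1 h.2)
  have hne : ∀ x y, x ≠ y → rank Z x ≠ rank Z y := by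
    intro x y h
    rcases before_trichotomy hZ h with h | h
    · exact (rank_lt_rank hc h).ne
    · exact (rank_lt_rank hc h).ne'
  refine ⟨fun x => ⟨rank Z x, rank_lt hc x⟩, ⟨?_, ?_⟩, ?_⟩
  · intro x y h
    by_contra hxy
    exact hne x y hxy (by simpa using h)
  · have h0 : rank Z 0 = 0 := by
      simp only [rank, Finset.card_eq_zero, Finset.filter_eq_empty_iff]
      rintro y - (h | h)
      · exact h.2 rfl
      · exact (hc.ne h).2.2 rfl
    exact Fin.ext (by simp [h0])
  · ext ⟨x, y, z⟩
    simp only [mem_ofRank]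
    refine ⟨key x y z, fun h => ?_⟩
    obtain ⟨h1, h2, h3⟩ := hc.ne h
    have h1 := hne _ _ h1
    have h2 := hne _ _ h2
    have h3 := hne _ _ h3
    by_contra h'
    refine hc.asymm _ _ _ h (key z y x ?_)
    simp only [Cyc] at *
    omega

/-- The rank recovers the numbering from its cyclic order, so `ofRank` is injective on rank
functions. -/
theorem rank_ofRank {M : ℕ} [NeZero M] {f : Fin M → Fin M} (hf : IsRank f) (x : Fin M) :
    rank (ofRank f) x = f x := by
  classical
  have hbij : Function.Bijective f := Finite.injective_iff_bijective.1 hf.1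
  have h : ∀ y, Before (ofRank f) y x ↔ f y < f x := by
    intro y
    have h0 := hf.val_zero
    have h1 : y ≠ 0 → (f y : ℕ) ≠ f 0 := hf.val_ne
    have h2 : x ≠ 0 → (f x : ℕ) ≠ f 0 := hf.val_ne
    simp only [Before, mem_ofRank, Cyc, Fin.lt_def]
    rcases eq_or_ne y 0 with rfl | hy
    · rcases eq_or_ne x 0 with rfl | hx
      · simp
      · have := h2 hx
        simp only [ne_eq, hx, not_false_eq_true, and_self, true_or, true_iff]
        omega
    · have := h1 hy
      simp only [hy, false_and, false_or]
      omega
  simp only [rank, h]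
  rw [← Fin.card_Iio (f x), ← Finset.card_image_of_injective _ hf.1]
  congr 1
  ext a
  obtain ⟨y, rfl⟩ := hbij.2 a
  simp [hf.1.eq_iff]

theorem injOn_ofRank {M : ℕ} [NeZero M] :
    Set.InjOn (ofRank (M := M)) {f | IsRank f} := by
  intro f hf f' hf' h
  funext x
  exact Fin.ext (by rw [← rank_ofRank hf, ← rank_ofRank hf', h])

open Classical in
/-- Counting total cyclic orders amounts to counting rank functions. -/
theorem ncard_eq_card_filter {M : ℕ} [NeZero M] {S : Set (Set (Fin M × Fin M × Fin M))}
    (hS : ∀ Z ∈ S, IsTotalCyclicOrder Z) :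
    S.ncard = (Finset.univ.filter fun f : Fin M → Fin M => IsRank f ∧ ofRank f ∈ S).card := by
  rw [← Set.ncard_coe_finset, ← Set.InjOn.ncard_image (f := ofRank)]
  · congr 1
    ext Z
    simp only [Set.mem_image, Finset.coe_filter, Finset.mem_univ, true_and, Set.mem_ofPred_eq]
    constructor
    · intro h
      obtain ⟨f, hf, rfl⟩ := exists_ofRank_eq (hS Z h)
      exact ⟨f, ⟨hf, h⟩, rfl⟩
    · rintro ⟨f, ⟨-, h⟩, rfl⟩
      exact h
  · exact injOn_ofRank.mono fun f hf => by simp at hf; exact hf.1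

/-- The number of positions strictly between two others, running forward and possibly past the
cut at `0`. -/
theorem content_ofRank {M : ℕ} [NeZero M] {f : Fin M → Fin M} (hf : IsRank f) {x y : Fin M}
    (h : x ≠ y) : content (ofRank f) x y =
      if (f x : ℕ) < f y then (f y : ℕ) - f x - 1 else M + f y - f x - 1 := by
  classical
  have hbij : Function.Bijective f := Finite.injective_iff_bijective.1 hf.1
  have hne := hf.val_ne h
  have h1 : content (ofRank f) x y =
      (Finset.univ.filter fun a : Fin M => Cyc (f x) a (f y)).card := by
    rw [content, ← Set.ncard_image_of_injective _ hf.1, ← Set.ncard_coe_finset]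
    congr 1
    ext a
    obtain ⟨z, rfl⟩ := hbij.2 a
    simp [hf.1.eq_iff]
  rw [h1]
  split_ifs with hlt
  · rw [← Fin.card_Ioo]
    congr 1
    ext a
    simp only [Finset.mem_filter, Finset.mem_univ, true_and, Finset.mem_Ioo]
    simp only [Cyc, Fin.lt_def]
    omega
  · have h2 : (Finset.univ.filter fun a : Fin M => Cyc (f x) a (f y)) =
        (Finset.Icc (f y) (f x))ᶜ := by
      ext a
      simp only [Finset.mem_filter, Finset.mem_univ, true_and, Finset.mem_compl,
        Finset.mem_Icc]
      simp only [Cyc, Fin.le_def]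
      omega
    rw [h2, Finset.card_compl, Fin.card_Icc, Fintype.card_fin]
    omega

/-! ### Inserting a point into one of four arcs -/

/-- The monomial `∏ X_ℓ ^ (v ℓ)`. -/
noncomputable def mon {m : ℕ} (v : Fin m → ℕ) : MvPolynomial (Fin m) ℤ :=
  MvPolynomial.monomial (Finsupp.equivFunOnFinite.symm v) 1

theorem mon_eq_prod {m : ℕ} (v : Fin m → ℕ) : mon v = ∏ ℓ, MvPolynomial.X ℓ ^ v ℓ := by
  rw [mon, MvPolynomial.monomial_eq, Finsupp.prod_fintype _ _ (by simp)]
  simp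

/-- The exponents of the `k`-th monomial in the image of `∏ X_ℓ ^ (s ℓ)` under `Φ_{a,b,c}`. -/
def phiExp {m : ℕ} (a b c : Fin m) (s : Fin m → ℕ) (k : ℕ) (ℓ : Fin m) : ℕ :=
  (if ℓ = b ∨ ℓ = c then 0 else s ℓ) + (if ℓ = a then s b + 1 else 0) +
    (if ℓ = b then s c - k else 0) + (if ℓ = c then k else 0)

theorem Phi_mon {m : ℕ} (a b c : Fin m) (s : Fin m → ℕ) :
    Phi a b c (mon s) = ∑ k ∈ Finset.range (s c + 1), mon (phiExp a b c s k) := by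
  have hX : ∀ (x : Fin m) (e : ℕ), (MvPolynomial.X x : MvPolynomial (Fin m) ℤ) ^ e =
      ∏ ℓ, MvPolynomial.X ℓ ^ (if ℓ = x then e else 0) := by
    intro x e
    simp [pow_ite]
  rw [mon, Phi_monomial, PhiMonomial, Finset.mul_sum]
  refine Finset.sum_congr rfl fun k _ => ?_
  have h1 : (∏ ℓ ∈ Finset.univ \ {b, c}, (MvPolynomial.X ℓ : MvPolynomial (Fin m) ℤ) ^ s ℓ) =
      ∏ ℓ, MvPolynomial.X ℓ ^ (if ℓ = b ∨ ℓ = c then 0 else s ℓ) := by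
    rw [← Finset.prod_subset (Finset.subset_univ (Finset.univ \ {b, c}))]
    · refine Finset.prod_congr rfl fun ℓ hℓ => ?_
      simp only [Finset.mem_sdiff, Finset.mem_univ, true_and, Finset.mem_insert,
        Finset.mem_singleton] at hℓ
      rw [if_neg hℓ]
    · intro ℓ _ hℓ
      simp only [Finset.mem_sdiff, Finset.mem_univ, true_and, Finset.mem_insert,
        Finset.mem_singleton, not_not] at hℓ
      rw [if_pos hℓ, pow_zero]
  simp only [Finsupp.equivFunOnFinite_symm_apply_apply] at *
  rw [h1, hX a, hX b, hX c, mon_eq_prod, ← Finset.prod_mul_distrib, ← Finset.prod_mul_distrib,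
    ← Finset.prod_mul_distrib]
  refine Finset.prod_congr rfl fun ℓ _ => ?_
  rw [phiExp, pow_add, pow_add, pow_add]
  ring

/-- The chain of type `α` formed by `1, 2, N - 1, N`, in terms of the ranks `b, c, d` of
`2, N - 1, N` (the rank of `1` is `0`). -/
def RankChain : ChainType → ℕ → ℕ → ℕ → Prop
  | .c1, b, c, d => b < c ∧ c < d
  | .c2, b, c, d => c < b ∧ b < d
  | .c3, b, c, d => c < d ∧ d < b
  | .c4, b, c, d => b < d ∧ d < c
  | .c5, b, c, d => d < b ∧ b < c
  | .c6, b, c, d => d < c ∧ c < b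

/-- The lengths of the four arcs of a chain of type `α`, in the order in which they are the
exponents of `X_1, …, X_4`, in terms of the ranks `b, c, d` of `2, N - 1, N` on a circle with
`M` positions. -/
def arcs (M : ℕ) : ChainType → ℕ → ℕ → ℕ → Fin 4 → ℕ
  | .c1, b, c, d => ![d - c - 1, M - d - 1, b - 1, c - b - 1]
  | .c2, b, c, d => ![b - c - 1, M - d - 1, c - 1, d - b - 1]
  | .c3, b, c, d => ![b - d - 1, M - b - 1, c - 1, d - c - 1]
  | .c4, b, c, d => ![c - d - 1, M - c - 1, b - 1, d - b - 1]
  | .c5, b, c, d => ![b - d - 1, M - c - 1, d - 1, c - b - 1]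
  | .c6, b, c, d => ![b - c - 1, M - b - 1, d - 1, c - d - 1]

/-- `step e α β` holds the indices of the operator through which the chains of type `β` for `w`
contribute to the chains of type `α` for the word `w` followed by the letter `e`. -/
def step : Letter → ChainType → ChainType → Option (Fin 4 × Fin 4 × Fin 4)
  | .plus, .c1, .c1 => some (3, 0, 1)
  | .plus, .c1, .c2 => some (2, 0, 1)
  | .plus, .c1, .c4 => some (1, 1, 0)
  | .plus, .c2, .c3 => some (2, 3, 1)
  | .plus, .c2, .c5 => some (1, 1, 3)
  | .plus, .c3, .c3 => some (2, 3, 0)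
  | .plus, .c3, .c5 => some (1, 3, 0)
  | .plus, .c3, .c6 => some (0, 0, 3)
  | .plus, .c4, .c1 => some (0, 0, 3)
  | .plus, .c5, .c1 => some (3, 0, 2)
  | .plus, .c5, .c2 => some (0, 0, 2)
  | .plus, .c6, .c3 => some (3, 3, 2)
  | .minus, .c1, .c4 => some (0, 0, 1)
  | .minus, .c2, .c6 => some (0, 3, 1)
  | .minus, .c2, .c5 => some (3, 3, 1)
  | .minus, .c3, .c6 => some (3, 3, 0)
  | .minus, .c4, .c4 => some (1, 0, 3)
  | .minus, .c4, .c2 => some (2, 0, 3)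
  | .minus, .c4, .c1 => some (3, 3, 0)
  | .minus, .c5, .c4 => some (1, 0, 2)
  | .minus, .c5, .c2 => some (2, 2, 0)
  | .minus, .c6, .c6 => some (0, 3, 2)
  | .minus, .c6, .c5 => some (1, 3, 2)
  | .minus, .c6, .c3 => some (2, 2, 3)
  | _, _, _ => none

/-- The operator described by `step`, which is zero if there is no contribution. -/
noncomputable def stepMap (e : Letter) (α β : ChainType) :
    MvPolynomial (Fin 4) ℤ →ₗ[ℤ] MvPolynomial (Fin 4) ℤ :=
  match step e α β with
  | some (a, b, c) => Phi a b c
  | none => 0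

/-- The new rank of an element of rank `p` after an insertion just behind rank `t`. -/
def shift (t p : ℕ) : ℕ := if p ≤ t then p else p + 1

/-- `Oriented` in terms of ranks. -/
def RankOriented : Letter → ℕ → ℕ → ℕ → Prop
  | .plus, a, b, c => Cyc a b c
  | .minus, a, b, c => Cyc c b a

/-- The condition that inserting the element `N + 1` just behind rank `t` produces a chain of
type `α` for a word with the additional letter `e`; here `b, c, d` are the ranks of
`2, N - 1, N` before the insertion. -/
def Insertable (e : Letter) (α : ChainType) (b c d t : ℕ) : Prop :=
  RankOriented e (shift t c) (shift t d) (t + 1) ∧ RankChain α (shift t b) (shift t d) (t + 1)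

/-- The rank of the starting point of each arc of a chain of type `α`, the arcs being listed as
in `arcs`. -/
def arcStart : ChainType → ℕ → ℕ → ℕ → Fin 4 → ℕ
  | .c1, b, c, d => ![c, d, 0, b]
  | .c2, b, c, d => ![c, d, 0, b]
  | .c3, b, c, d => ![d, b, 0, c]
  | .c4, b, c, d => ![d, c, 0, b]
  | .c5, b, c, d => ![d, c, 0, b]
  | .c6, b, c, d => ![c, b, 0, d]

open Classical in
/-- If the admissible insertions are those into one arc `z`, and the exponents vary as in
`Φ_{x,y,z}`, along the arc or against it, then they add up to a value of `Φ_{x,y,z}`. -/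
theorem sum_eq_Phi {M b c d : ℕ} {β : ChainType} {x y z : Fin 4} {P : ℕ → Prop}
    {v : ℕ → Fin 4 → ℕ}
    (hM : arcStart β b c d z + arcs M β b c d z + 1 ≤ M)
    (hv : (∀ k ≤ arcs M β b c d z, ∀ ℓ,
        v (arcStart β b c d z + k) ℓ = phiExp x y z (arcs M β b c d) k ℓ) ∨
      ∀ k ≤ arcs M β b c d z, ∀ ℓ,
        v (arcStart β b c d z + k) ℓ =
          phiExp x y z (arcs M β b c d) (arcs M β b c d z - k) ℓ)
    (hP : ∀ t < M, P t ↔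
      arcStart β b c d z ≤ t ∧ t < arcStart β b c d z + arcs M β b c d z + 1) :
    (∑ t ∈ Finset.range M, if P t then mon (v t) else 0) =
      Phi x y z (mon (arcs M β b c d)) := by
  generalize arcStart β b c d z = lo at *
  generalize arcs M β b c d = s at *
  rw [Phi_mon, ← Finset.sum_filter]
  have h : (Finset.range M).filter P = Finset.Ico lo (lo + (s z + 1)) := by
    ext t
    simp only [Finset.mem_filter, Finset.mem_range, Finset.mem_Ico]
    constructor
    · rintro ⟨h1, h2⟩
      have := (hP t h1).1 h2
      omega
    · rintro h
      exact ⟨by omega, (hP t (by omega)).2 (by omega)⟩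
  rw [h, Finset.sum_Ico_eq_sum_range, Nat.add_sub_cancel_left]
  rcases hv with hv | hv
  · refine Finset.sum_congr rfl fun k hk => ?_
    rw [funext (hv k (Nat.lt_succ_iff.1 (Finset.mem_range.1 hk)))]
  · rw [← Finset.sum_range_reflect]
    refine Finset.sum_congr rfl fun k hk => ?_
    have hk := Finset.mem_range.1 hk
    rw [funext (hv (s z + 1 - 1 - k) (by omega))]
    congr 2
    omega

set_option maxHeartbeats 4000000 in
open Classical in
/-- For a chain of type `β`, the admissible positions of `N + 1` fill exactly one of the four
arcs, or there are none. The element `N - 1` ceases to be marked, so the two arcs next to it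
merge: this is the factor `X_a ^ (i_b + 1)` in `Φ_{a,b,c}`, while the sum describes the
possible ways to cut the arc `c` in two. -/
theorem sum_insertions {M b c d : ℕ} (hb : 0 < b) (hc : 0 < c) (hd : 0 < d) (hbM : b < M)
    (hcM : c < M) (hdM : d < M) (e : Letter) (α β : ChainType) (h : RankChain β b c d) :
    (∑ t ∈ Finset.range M, if Insertable e α b c d t then
      mon (arcs (M + 1) α (shift t b) (shift t d) (t + 1)) else 0) =
    stepMap e α β (mon (arcs M β b c d)) := by
  cases β <;> cases e <;> cases α <;> simp only [stepMap, step, LinearMap.zero_apply] <;>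
    simp only [RankChain] at h <;>
  first
  -- no position is admissible
  | refine Finset.sum_eq_zero fun t ht => if_neg ?_
    simp only [Insertable, RankOriented, RankChain, Cyc, shift]
    grind
  -- the admissible positions are those of one arc
  | refine sum_eq_Phi ?_ ?_ ?_
    · simp [arcs, arcStart]
      omega
    · first
      | left
        intro k hk ℓ
        simp only [arcs, Matrix.cons_val] at hk
        fin_cases ℓ <;> simp [phiExp, arcs, shift, arcStart] <;> grind
      | right
        intro k hk ℓ
        simp only [arcs, Matrix.cons_val] at hk
        fin_cases ℓ <;> simp [phiExp, arcs, shift, arcStart] <;> grind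
    · intro t ht
      simp only [Insertable, RankOriented, RankChain, Cyc, shift, arcs, arcStart, Matrix.cons_val]
      grind

/-! ### The generating polynomials as sums over rank functions -/

theorem mem_chainClass_iff {n : ℕ} (hn : 2 ≤ n) (w : Fin n → Letter) (α : ChainType)
    {f : Fin (n + 2) → Fin (n + 2)} (hf : IsRank f) :
    ofRank f ∈ chainClass w α ↔
      ofRank f ∈ classP w ∧ RankChain α (f (two n)) (f (penult n)) (f (ult n)) := by
  have h0 : (f (one n) : ℕ) = 0 := hf.val_zero
  have h12 : one n ≠ two n := by simp [one, two]
  have h13 : one n ≠ penult n := by simp [one, penult]; omega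
  have h14 : one n ≠ ult n := by simp [one, ult]
  have h23 : two n ≠ penult n := by simp [two, penult]; omega
  have h24 : two n ≠ ult n := by simp [two, ult]; omega
  have h34 : penult n ≠ ult n := by simp [penult, ult]
  have k12 := hf.val_ne h12
  have k13 := hf.val_ne h13
  have k14 := hf.val_ne h14
  have k23 := hf.val_ne h23
  have k24 := hf.val_ne h24
  have k34 := hf.val_ne h34
  have hinj : Function.Injective (chainOf n α) := by
    intro i j h
    cases α <;> fin_cases i <;> fin_cases j <;> simp_all [chainOf, eq_comm]
  have hi : ∀ P : ∀ i, i + 2 < 4 → Prop, (∀ i (hi : i + 2 < 4), P i hi) ↔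
      P 0 (by norm_num) ∧ P 1 (by norm_num) := by
    intro P
    refine ⟨fun h => ⟨h 0 _, h 1 _⟩, fun h i hi => ?_⟩
    obtain rfl | rfl : i = 0 ∨ i = 1 := by omega
    exacts [h.1, h.2]
  refine and_congr_right fun _ => ?_
  simp only [IsZChain, hinj, true_and, hi, mem_ofRank]
  cases α <;> simp [chainOf, RankChain, Cyc] <;> omega

open Classical in
/-- The rank functions of the cyclic orders in `𝓡_w^{(α)}`. -/
noncomputable def ranks {n : ℕ} (w : Fin n → Letter) (α : ChainType) :
    Finset (Fin (n + 2) → Fin (n + 2)) :=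
  Finset.univ.filter fun f => IsRank f ∧ ofRank f ∈ chainClass w α

/-- The arcs of the chain of type `α` formed by `1, 2, N - 1, N` in the cyclic order with rank
function `f`. -/
def arcsOf {n : ℕ} (α : ChainType) (f : Fin (n + 2) → Fin (n + 2)) : Fin 4 → ℕ :=
  arcs (n + 2) α (f (two n)) (f (penult n)) (f (ult n))

/-- The arcs contain all elements but the four marked ones, so the sum defining `genR` runs over
all exponents that occur. -/
theorem sum_arcsOf {n : ℕ} (hn : 2 ≤ n) {w : Fin n → Letter} {α : ChainType}
    {f : Fin (n + 2) → Fin (n + 2)} (hf : f ∈ ranks w α) : ∑ ℓ, arcsOf α f ℓ = n - 2 := by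
  simp only [ranks, Finset.mem_filter, Finset.mem_univ, true_and] at hf
  obtain ⟨hf, hα⟩ := hf
  rw [mem_chainClass_iff hn w α hf] at hα
  have hα := hα.2
  have h0 := hf.val_zero
  have h2 : (f (two n) : ℕ) ≠ f 0 := hf.val_ne (by simp [two])
  have h3 : (f (penult n) : ℕ) ≠ f 0 := hf.val_ne (by simp [penult, Fin.ext_iff]; omega)
  have h4 : (f (ult n) : ℕ) ≠ f 0 := hf.val_ne (by simp [ult, Fin.ext_iff])
  rw [Fin.sum_univ_four]
  cases α <;> simp only [RankChain] at hα <;> simp [arcsOf, arcs] <;> omega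

open Classical in
/-- The numbers `g` count rank functions by their arcs; in particular, `arcs` lists the arcs in the
order prescribed in the definition of `g`. -/
theorem g_eq {n : ℕ} (hn : 2 ≤ n) (w : Fin n → Letter) (α : ChainType) (v : Fin 4 → ℕ) :
    g w α (v 0) (v 1) (v 2) (v 3) = ((ranks w α).filter fun f => arcsOf α f = v).card := by
  have h : ∀ (y : Fin 4 → Fin (n + 2)) (u : Fin 4 → ℕ),
      (∀ f, IsRank f → RankChain α (f (two n)) (f (penult n)) (f (ult n)) →
        (multiContent (ofRank f) y = u ↔ arcsOf α f = v)) →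
      {Z | Z ∈ chainClass w α ∧ multiContent Z y = u}.ncard =
        ((ranks w α).filter fun f => arcsOf α f = v).card := by
    intro y u h
    rw [ncard_eq_card_filter fun Z hZ => hZ.1.1.1]
    congr 1
    ext f
    simp only [ranks, Finset.mem_filter, Finset.mem_univ, true_and, Set.mem_ofPred_eq, and_assoc]
    refine and_congr_right fun hf => and_congr_right fun hα => ?_
    exact h f hf ((mem_chainClass_iff hn w α hf).1 hα).2
  have hne : one n ≠ two n ∧ one n ≠ penult n ∧ one n ≠ ult n ∧ two n ≠ penult n ∧
      two n ≠ ult n ∧ penult n ≠ ult n := by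
    simp [one, two, penult, ult]
    omega
  obtain ⟨h12, h13, h14, h23, h24, h34⟩ := hne
  cases α <;> refine h _ _ fun f hf hα => ?_
  all_goals
    have k1 : (f (one n) : ℕ) = 0 := hf.val_zero
    have k2 := hf.val_ne h12
    have k3 := hf.val_ne h13
    have k4 := hf.val_ne h14
    simp only [RankChain] at hα
    simp only [funext_iff, Fin.forall_fin_succ, multiContent, arcsOf, arcs]
    simp [content_ofRank hf, h12, h13, h14, h23, h24, h34, h12.symm, h13.symm, h14.symm,
      h23.symm, h24.symm, h34.symm, k1]
    grind

theorem genR_eq {n : ℕ} (hn : 2 ≤ n) (w : Fin n → Letter) (α : ChainType) :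
    genR w α = ∑ f ∈ ranks w α, mon (arcsOf α f) := by
  classical
  rw [genR, ← Finset.sum_fiberwise_of_maps_to (g := fun f => arcsOf α f)
    (t := Finset.Nat.antidiagonalTuple 4 (n - 2))
    fun f hf => Finset.Nat.mem_antidiagonalTuple.2 (sum_arcsOf hn hf)]
  refine Finset.sum_congr rfl fun v _ => ?_
  rw [g_eq hn, Finset.sum_congr rfl fun f hf => by rw [(Finset.mem_filter.1 hf).2],
    Finset.sum_const, mon_eq_prod, Fin.prod_univ_four]
  simp

/-! ### Inserting the largest element -/

/-- The rank function obtained from `f` by inserting a new largest element just behind the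
element of rank `t`. -/
def insertRank {M : ℕ} (f : Fin M → Fin M) (t : Fin M) : Fin (M + 1) → Fin (M + 1) :=
  Fin.snoc (α := fun _ => Fin (M + 1)) (fun y => t.succ.succAbove (f y)) t.succ

theorem insertRank_castSucc {M : ℕ} (f : Fin M → Fin M) (t y : Fin M) :
    (insertRank f t y.castSucc : ℕ) = shift t (f y) := by
  simp only [insertRank, Fin.snoc_castSucc, shift, Fin.succAbove, Fin.lt_def]
  split_ifs <;> simp_all

theorem insertRank_last {M : ℕ} (f : Fin M → Fin M) (t : Fin M) :
    (insertRank f t (Fin.last M) : ℕ) = t + 1 := by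
  simp [insertRank]

theorem isRank_insertRank {M : ℕ} [NeZero M] {f : Fin M → Fin M} (hf : IsRank f) (t : Fin M) :
    IsRank (insertRank f t) := by
  constructor
  · rw [insertRank, Fin.snoc_injective_iff]
    exact ⟨Fin.succAbove_right_injective.comp hf.1, by rintro ⟨y, hy⟩; simp at hy⟩
  · ext
    have := insertRank_castSucc f t 0
    rw [hf.val_zero] at this
    simpa [shift] using this

theorem exists_insertRank {M : ℕ} [NeZero M] {f' : Fin (M + 1) → Fin (M + 1)} (hf' : IsRank f') :
    ∃ f t, IsRank f ∧ insertRank f t = f' := by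
  have hne : f' (Fin.last M) ≠ 0 := by
    rw [← hf'.2]
    exact hf'.1.ne (by simp [Fin.ext_iff, NeZero.ne M])
  obtain ⟨t, ht⟩ := Fin.exists_succ_eq.2 hne
  have h : ∀ y : Fin M, ∃ z, t.succ.succAbove z = f' y.castSucc := fun y =>
    Fin.exists_succAbove_eq (by rw [ht]; exact hf'.1.ne (Fin.castSucc_lt_last y).ne)
  choose f hf using h
  refine ⟨f, t, ⟨fun x y hxy => ?_, ?_⟩, ?_⟩
  · have := hf x
    rw [hxy, hf y] at this
    exact (Fin.castSucc_injective _ (hf'.1 this)).symm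
  · have h0 : t.succ.succAbove (f 0) = 0 := by rw [hf 0, Fin.castSucc_zero', hf'.2]
    have h1 : ((t.succ.succAbove (f 0) : Fin (M + 1)) : ℕ) = 0 := by rw [h0]; rfl
    ext
    rw [Fin.succAbove] at h1
    split_ifs at h1 <;> simp_all
  · funext y
    refine Fin.lastCases ?_ (fun y => ?_) y
    · simp [insertRank, ht]
    · simp [insertRank, hf]

theorem insertRank_injective {M : ℕ} {f g : Fin M → Fin M} {t u : Fin M}
    (h : insertRank f t = insertRank g u) : f = g ∧ t = u := by
  obtain ⟨h1, h2⟩ := Fin.snoc_injective2 h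
  obtain rfl := Fin.succ_injective _ h2
  exact ⟨funext fun y => Fin.succAbove_right_injective (congrFun h1 y), rfl⟩

open Classical in
/-- Deleting the largest element identifies the rank functions on `M + 1` elements with the
pairs of a rank function on `M` elements and a position. -/
theorem sum_isRank_succ {M : ℕ} [NeZero M] {A : Type*} [AddCommMonoid A]
    (F : (Fin (M + 1) → Fin (M + 1)) → A) :
    (∑ f' with IsRank f', F f') =
      ∑ f : Fin M → Fin M with IsRank f, ∑ t : Fin M, F (insertRank f t) := by
  rw [← Finset.sum_product']
  symm
  refine Finset.sum_bij (fun p _ => insertRank p.1 p.2) ?_ ?_ ?_ ?_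
  · intro p hp
    simp only [Finset.mem_product, Finset.mem_filter, Finset.mem_univ, true_and, and_true] at *
    exact isRank_insertRank hp _
  · intro p _ q _ h
    exact Prod.ext_iff.2 (insertRank_injective h)
  · intro f' hf'
    obtain ⟨f, t, hf, h⟩ := exists_insertRank (by simpa using hf')
    exact ⟨(f, t), by simpa using hf, h⟩
  · intros
    rfl

theorem cyc_shift (t a b c : ℕ) : Cyc (shift t a) (shift t b) (shift t c) ↔ Cyc a b c := by
  simp only [Cyc, shift]
  split_ifs <;> omega

theorem oriented_ofRank {M : ℕ} (f : Fin M → Fin M) (e : Letter) (x y z : Fin M) :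
    Oriented (ofRank f) e x y z ↔ RankOriented e (f x) (f y) (f z) := by
  cases e <;> rfl

theorem rankOriented_shift (e : Letter) (t a b c : ℕ) :
    RankOriented e (shift t a) (shift t b) (shift t c) ↔ RankOriented e a b c := by
  cases e <;> exact cyc_shift ..

theorem mem_classP_iff {n : ℕ} (w : Fin n → Letter) {f : Fin (n + 2) → Fin (n + 2)}
    (hf : IsRank f) : ofRank f ∈ classP w ↔ ∀ i : Fin n, RankOriented (w i)
      (f ⟨i, by omega⟩) (f ⟨i + 1, by omega⟩) (f ⟨i + 2, by omega⟩) := by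
  simp only [classP, Set.mem_ofPred_eq, isTotalCyclicOrder_ofRank hf, true_and, oriented_ofRank]

theorem insertRank_mem_classP_iff {n : ℕ} (w : Fin n → Letter) (e : Letter)
    {f : Fin (n + 2) → Fin (n + 2)} (hf : IsRank f) (t : Fin (n + 2)) :
    ofRank (insertRank f t) ∈ classP (append w e) ↔ ofRank f ∈ classP w ∧
      RankOriented e (shift t (f (penult n))) (shift t (f (ult n))) (t + 1) := by
  rw [mem_classP_iff (append w e) (isRank_insertRank hf t), mem_classP_iff w hf,
    Fin.forall_fin_succ']
  refine and_congr (forall_congr' fun i => ?_) ?_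
  · have h := rankOriented_shift (w i) t (f ⟨i, by omega⟩) (f ⟨i + 1, by omega⟩)
      (f ⟨i + 2, by omega⟩)
    rw [← insertRank_castSucc, ← insertRank_castSucc, ← insertRank_castSucc] at h
    rw [append, Fin.snoc_castSucc]
    exact h
  · rw [append, Fin.snoc_last, ← insertRank_castSucc, ← insertRank_castSucc,
      ← insertRank_last f t]
    rfl

/-! ### The recurrences -/

theorem insertRank_mem_chainClass_iff {n : ℕ} (hn : 2 ≤ n) (w : Fin n → Letter) (e : Letter)
    (α : ChainType) {f : Fin (n + 2) → Fin (n + 2)} (hf : IsRank f) (t : Fin (n + 2)) :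
    ofRank (insertRank f t) ∈ chainClass (append w e) α ↔ ofRank f ∈ classP w ∧
      Insertable e α (f (two n)) (f (penult n)) (f (ult n)) t := by
  rw [mem_chainClass_iff (by omega) _ _ (isRank_insertRank hf t),
    insertRank_mem_classP_iff w e hf, and_assoc, Insertable, ← insertRank_castSucc f t (two n),
    ← insertRank_last f t, ← insertRank_castSucc f t (ult n)]
  rfl

theorem arcsOf_insertRank {n : ℕ} (α : ChainType) (f : Fin (n + 2) → Fin (n + 2))
    (t : Fin (n + 2)) : arcsOf α (insertRank f t) =
      arcs (n + 2 + 1) α (shift t (f (two n))) (shift t (f (ult n))) (t + 1) := by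
  rw [← insertRank_castSucc, ← insertRank_castSucc, ← insertRank_last f t]
  rfl

noncomputable instance : DecidableEq ChainType := Classical.decEq _

noncomputable instance : Fintype ChainType where
  elems := {.c1, .c2, .c3, .c4, .c5, .c6}
  complete := by rintro (_ | _ | _ | _ | _ | _) <;> simp

theorem sum_chainType {A : Type*} [AddCommMonoid A] (F : ChainType → A) :
    ∑ β, F β = F .c1 + F .c2 + F .c3 + F .c4 + F .c5 + F .c6 := by
  have h : (Finset.univ : Finset ChainType) = {.c1, .c2, .c3, .c4, .c5, .c6} := rfl
  simp [h, add_assoc]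

theorem exists_rankChain {b c d : ℕ} (h1 : b ≠ c) (h2 : b ≠ d) (h3 : c ≠ d) :
    ∃ β, RankChain β b c d := by
  by_contra h
  push Not at h
  have h1 := h .c1
  have h2 := h .c2
  have h3 := h .c3
  have h4 := h .c4
  have h5 := h .c5
  have h6 := h .c6
  simp only [RankChain] at *
  omega

theorem RankChain.unique {b c d : ℕ} {α β : ChainType} (h : RankChain α b c d)
    (h' : RankChain β b c d) : α = β := by
  cases α <;> cases β <;> first | rfl | (simp only [RankChain] at h h'; omega)

/-- The twelve recurrences in uniform notation. -/
theorem genR_append {n : ℕ} (hn : 2 ≤ n) (w : Fin n → Letter) (e : Letter) (α : ChainType) :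
    genR (append w e) α = ∑ β, stepMap e α β (genR w β) := by
  classical
  have hne : ∀ f : Fin (n + 2) → Fin (n + 2), IsRank f →
      ((f (two n) : ℕ) ≠ f (penult n) ∧ (f (two n) : ℕ) ≠ f (ult n) ∧
        (f (penult n) : ℕ) ≠ f (ult n)) ∧
      0 < (f (two n) : ℕ) ∧ 0 < (f (penult n) : ℕ) ∧ 0 < (f (ult n) : ℕ) := by
    intro f hf
    have h0 := hf.val_zero
    have h1 := hf.val_ne (show two n ≠ 0 by simp [two])
    have h2 := hf.val_ne (show penult n ≠ 0 by simp [penult, Fin.ext_iff]; omega)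
    have h3 := hf.val_ne (show ult n ≠ 0 by simp [ult, Fin.ext_iff])
    refine ⟨⟨hf.val_ne ?_, hf.val_ne ?_, hf.val_ne ?_⟩, ?_, ?_, ?_⟩
    · simp [two, penult]; omega
    · simp [two, ult]; omega
    · simp [penult, ult]
    all_goals omega
  have hL : genR (append w e) α = ∑ f : Fin (n + 2) → Fin (n + 2) with IsRank f,
      if ofRank f ∈ classP w then ∑ t ∈ Finset.range (n + 2),
        (if Insertable e α (f (two n)) (f (penult n)) (f (ult n)) t then
          mon (arcs (n + 2 + 1) α (shift t (f (two n))) (shift t (f (ult n))) (t + 1)) else 0)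
      else 0 := by
    rw [genR_eq (by omega), ranks, ← Finset.filter_filter, Finset.sum_filter, sum_isRank_succ]
    refine Finset.sum_congr rfl fun f hf => ?_
    have hf : IsRank f := by simpa using hf
    rw [Finset.sum_range]
    simp only [insertRank_mem_chainClass_iff hn w e α hf, arcsOf_insertRank]
    split_ifs with h <;> simp [h]
  have hR : ∀ β, stepMap e α β (genR w β) = ∑ f : Fin (n + 2) → Fin (n + 2) with IsRank f,
      if ofRank f ∈ classP w ∧ RankChain β (f (two n)) (f (penult n)) (f (ult n)) then
        stepMap e α β (mon (arcsOf β f)) else 0 := by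
    intro β
    rw [genR_eq hn, map_sum, ranks, ← Finset.filter_filter, Finset.sum_filter]
    refine Finset.sum_congr rfl fun f hf => ?_
    exact if_congr (mem_chainClass_iff hn w β (by simpa using hf)) rfl rfl
  rw [hL, Finset.sum_congr rfl fun β _ => hR β, Finset.sum_comm]
  refine Finset.sum_congr rfl fun f hf => ?_
  have hf : IsRank f := by simpa using hf
  obtain ⟨⟨h1, h2, h3⟩, p1, p2, p3⟩ := hne f hf
  obtain ⟨γ, hγ⟩ := exists_rankChain h1 h2 h3
  -- each numbering has exactly one chain type `γ`, which alone contributes on the right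
  rw [Finset.sum_eq_single γ]
  · simp only [hγ, and_true]
    refine if_congr Iff.rfl ?_ rfl
    exact sum_insertions p1 p2 p3 (Fin.is_lt _) (Fin.is_lt _) (Fin.is_lt _) e α γ hγ
  · intro β _ hβ
    exact if_neg fun h => hβ (h.2.unique hγ)
  · simp

/-! ### Words of length two -/

/-- The rank function of the only cyclic order on four elements with a chain of type `α`. -/
def initialRank : ChainType → Fin 4 → Fin 4
  | .c1 => ![0, 1, 2, 3]
  | .c2 => ![0, 2, 1, 3]
  | .c3 => ![0, 3, 1, 2]
  | .c4 => ![0, 1, 3, 2]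
  | .c5 => ![0, 2, 3, 1]
  | .c6 => ![0, 3, 2, 1]

theorem ranks_two (w : Fin 2 → Letter) (α : ChainType) [Decidable (w = initialWord α)] :
    ranks w α = if w = initialWord α then {initialRank α} else ∅ := by
  have h : ∀ f, f ∈ ranks w α ↔ w = initialWord α ∧ f = initialRank α := by
    intro f
    have hr : IsRank (initialRank α) := by
      constructor
      · intro i j h
        cases α <;> revert i j <;> decide
      · cases α <;> rfl
    have hw : ∀ f, f = initialRank α → ((∀ i : Fin 2, RankOriented (w i)
      (f ⟨i, by omega⟩) (f ⟨i + 1, by omega⟩) (f ⟨i + 2, by omega⟩)) ↔ w = initialWord α) := by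
      rintro f rfl
      rw [funext_iff, Fin.forall_fin_two, Fin.forall_fin_two]
      generalize w 0 = a
      generalize w 1 = b
      cases α <;> cases a <;> cases b <;> simp [RankOriented, Cyc, initialRank, initialWord]
    have hc : ∀ f, IsRank f →
        (RankChain α (f (two 2)) (f (penult 2)) (f (ult 2)) ↔ f = initialRank α) := by
      intro f hf
      have h0 := hf.val_zero
      have h1 := hf.val_ne (show two 2 ≠ 0 by decide)
      have h2 := hf.val_ne (show penult 2 ≠ 0 by decide)
      have h3 := hf.val_ne (show ult 2 ≠ 0 by decide)
      rw [show two 2 = 1 from rfl] at *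
      rw [show penult 2 = 2 from rfl] at *
      rw [show ult 2 = 3 from rfl] at *
      simp only [funext_iff, Fin.forall_fin_succ, Fin.ext_iff]
      cases α <;> simp [RankChain, initialRank] <;> omega
    simp only [ranks, Finset.mem_filter, Finset.mem_univ, true_and]
    constructor
    · rintro ⟨h1, h2⟩
      rw [mem_chainClass_iff le_rfl w α h1, hc f h1, mem_classP_iff w h1] at h2
      exact ⟨(hw f h2.2).1 h2.1, h2.2⟩
    · rintro ⟨h1, rfl⟩
      refine ⟨hr, ?_⟩
      rw [mem_chainClass_iff le_rfl w α hr, hc _ hr, mem_classP_iff w hr]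
      exact ⟨(hw _ rfl).2 h1, rfl⟩
  ext f
  rw [h]
  split_ifs with hw <;> simp [hw]

theorem genR_initialWord (α : ChainType) : genR (initialWord α) α = 1 := by
  classical
  have h : arcsOf (n := 2) α (initialRank α) = fun _ => 0 := by
    funext ℓ
    cases α <;> fin_cases ℓ <;> rfl
  rw [genR_eq le_rfl, ranks_two, if_pos rfl, Finset.sum_singleton, h, mon_eq_prod]
  simp

theorem genR_eq_zero {w : Fin 2 → Letter} {α : ChainType} (h : w ≠ initialWord α) :
    genR w α = 0 := by
  classical
  rw [genR_eq le_rfl, ranks_two, if_neg h, Finset.sum_empty]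

/-! ### Cardinalities -/

theorem eval_one_genR {n : ℕ} (hn : 2 ≤ n) (w : Fin n → Letter) (α : ChainType) :
    MvPolynomial.eval 1 (genR w α) = ((ranks w α).card : ℤ) := by
  simp [genR_eq hn, mon_eq_prod]

open Classical in
/-- If the orientations `η₁`, `η₂` amount to the chain type of `1, 2, N - 1, N` lying in `s`, then
`𝓡_w^{η₁, η₂}` is the disjoint union of the sets `𝓡_w^{(α)}` with `α` in `s`. -/
theorem ncard_classR {n : ℕ} (hn : 2 ≤ n) (w : Fin n → Letter) (η₁ η₂ : Letter)
    (s : Finset ChainType)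
    (hs : ∀ b c d : ℕ, 0 < b → 0 < c → 0 < d → b ≠ c → b ≠ d → c ≠ d →
      ((RankOriented η₁ c d 0 ∧ RankOriented η₂ d 0 b) ↔ ∃ α ∈ s, RankChain α b c d)) :
    ((classR w η₁ η₂).ncard : ℤ) = ∑ α ∈ s, MvPolynomial.eval 1 (genR w α) := by
  simp only [eval_one_genR hn]
  rw [← Nat.cast_sum, ncard_eq_card_filter fun Z hZ => hZ.1.1.1, ← Finset.card_biUnion]
  · congr 2
    ext f
    simp only [ranks, Finset.mem_filter, Finset.mem_univ, true_and, Finset.mem_biUnion]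
    have key : IsRank f → (ofRank f ∈ classR w η₁ η₂ ↔ ∃ α ∈ s, ofRank f ∈ chainClass w α) := by
      intro hf
      have h0 := hf.val_zero
      have h1 := hf.val_ne (show two n ≠ 0 by simp [two])
      have h2 := hf.val_ne (show penult n ≠ 0 by simp [penult, Fin.ext_iff]; omega)
      have h3 := hf.val_ne (show ult n ≠ 0 by simp [ult, Fin.ext_iff])
      have h := hs (f (two n)) (f (penult n)) (f (ult n)) (by omega) (by omega) (by omega)
        (hf.val_ne (by simp [two, penult]; omega)) (hf.val_ne (by simp [two, ult]; omega))
        (hf.val_ne (by simp [penult, ult]))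
      have h4 : (f (one n) : ℕ) = 0 := h0
      simp only [mem_chainClass_iff hn w _ hf, classR, classQ, Set.mem_ofPred_eq,
        oriented_ofRank, h4, and_assoc, h]
      tauto
    constructor
    · rintro ⟨hf, h⟩
      obtain ⟨α, hα, h⟩ := (key hf).1 h
      exact ⟨α, hα, hf, h⟩
    · rintro ⟨α, hα, hf, h⟩
      exact ⟨hf, (key hf).2 ⟨α, hα, h⟩⟩
  · intro α _ β _ hαβ
    refine Finset.disjoint_left.2 fun f hf hf' => hαβ ?_
    simp only [ranks, Finset.mem_filter, Finset.mem_univ, true_and] at hf hf'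
    have h1 := ((mem_chainClass_iff hn w α hf.1).1 hf.2).2
    exact h1.unique ((mem_chainClass_iff hn w β hf.1).1 hf'.2).2

end CyclicBoustrophedon

theorem theorem6 :
    -- the twelve recurrences
    (∀ (n : ℕ), 2 ≤ n → ∀ w : Fin n → Letter,
      genR (append w .plus) .c1 =
        Phi 3 0 1 (genR w .c1) + Phi 2 0 1 (genR w .c2) + Phi 1 1 0 (genR w .c4) ∧
      genR (append w .plus) .c2 =
        Phi 2 3 1 (genR w .c3) + Phi 1 1 3 (genR w .c5) ∧
      genR (append w .plus) .c3 =
        Phi 2 3 0 (genR w .c3) + Phi 1 3 0 (genR w .c5) + Phi 0 0 3 (genR w .c6) ∧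
      genR (append w .plus) .c4 =
        Phi 0 0 3 (genR w .c1) ∧
      genR (append w .plus) .c5 =
        Phi 3 0 2 (genR w .c1) + Phi 0 0 2 (genR w .c2) ∧
      genR (append w .plus) .c6 =
        Phi 3 3 2 (genR w .c3) ∧
      genR (append w .minus) .c1 =
        Phi 0 0 1 (genR w .c4) ∧
      genR (append w .minus) .c2 =
        Phi 0 3 1 (genR w .c6) + Phi 3 3 1 (genR w .c5) ∧
      genR (append w .minus) .c3 =
        Phi 3 3 0 (genR w .c6) ∧
      genR (append w .minus) .c4 =
        Phi 1 0 3 (genR w .c4) + Phi 2 0 3 (genR w .c2) + Phi 3 3 0 (genR w .c1) ∧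
      genR (append w .minus) .c5 =
        Phi 1 0 2 (genR w .c4) + Phi 2 2 0 (genR w .c2) ∧
      genR (append w .minus) .c6 =
        Phi 0 3 2 (genR w .c6) + Phi 1 3 2 (genR w .c5) + Phi 2 2 3 (genR w .c3)) ∧
    -- the initial tetrahedra, for words of length two
    ((∀ α : ChainType, genR (initialWord α) α = 1) ∧
      ∀ (w : Fin 2 → Letter) (α : ChainType), w ≠ initialWord α → genR w α = 0) ∧
    -- the cardinalities, as sums of all the entries of the tetrahedra
    (∀ (n : ℕ), 2 ≤ n → ∀ w : Fin n → Letter,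
      ((classR w .plus .plus).ncard : ℤ) =
        MvPolynomial.eval 1 (genR w .c1) + MvPolynomial.eval 1 (genR w .c2) ∧
      ((classR w .plus .minus).ncard : ℤ) = MvPolynomial.eval 1 (genR w .c3) ∧
      ((classR w .minus .plus).ncard : ℤ) = MvPolynomial.eval 1 (genR w .c4) ∧
      ((classR w .minus .minus).ncard : ℤ) =
        MvPolynomial.eval 1 (genR w .c5) + MvPolynomial.eval 1 (genR w .c6)) := by
  refine ⟨fun n hn w => ?_, ⟨genR_initialWord, fun w α => genR_eq_zero⟩, fun n hn w => ?_⟩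
  · refine ⟨?_, ?_, ?_, ?_, ?_, ?_, ?_, ?_, ?_, ?_, ?_, ?_⟩ <;>
      simp only [genR_append hn, sum_chainType, stepMap, step, LinearMap.zero_apply] <;> abel
  · refine ⟨?_, ?_, ?_, ?_⟩
    · rw [ncard_classR hn w _ _ {.c1, .c2}, Finset.sum_pair (by simp)]
      intros
      simp [RankOriented, RankChain, Cyc]
      omega
    · rw [ncard_classR hn w _ _ {.c3}, Finset.sum_singleton]
      intros
      simp [RankOriented, RankChain, Cyc]
      omega
    · rw [ncard_classR hn w _ _ {.c4}, Finset.sum_singleton]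
      intros
      simp [RankOriented, RankChain, Cyc]
      omega
    · rw [ncard_classR hn w _ _ {.c5, .c6}, Finset.sum_pair (by simp)]
      intros
      simp [RankOriented, RankChain, Cyc]
      omega
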